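/- A stabilizer ZX-calculus diagram is built from green nodes and red nodes with any numbers $n\ge 0$ of inputs and $m\ge 0$ of outputs and a phase in $\{0,\pi/2,\pi,-\pi/2\}$, Hadamard nodes (one input, one output), star nodes (no inputs or outputs), and edges (straight, crossing, or bent into cups and caps), by placing diagrams side by side and connecting outputs to inputs; the empty diagram is allowed. The interpretation $\llbracket D\rrbracket$ of a diagram $D$ with $n$ inputs and $m$ outputs is the complex $2^m\times 2^n$ matrix determined as follows. A green node with phase $\alpha$ is interpreted as $|0\rangle^{\otimes m}\langle 0|^{\otimes n}+e^{i\alpha}|1\rangle^{\otimes m}\langle 1|^{\otimes n}$, and a red node with phase $\beta$ as $|+\rangle^{\otimes m}\langle +|^{\otimes n}+e^{i\beta}|-\rangle^{\otimes m}\langle -|^{\otimes n}$, where $|\pm\rangle=\frac{1}{\sqrt2}(|0\rangle\pm|1\rangle)$ and zero-fold tensor powers are $1$. A Hadamard node is interpreted as $|+\rangle\langle 0|+|-\rangle\langle 1|$, a star node as $\frac12$, and the empty diagram as $1$. A straight edge is the identity on $\mathbb{C}^2$, a crossing is the swap of two qubits, a cup is $|00\rangle+|11\rangle$, and a cap is $\langle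 00|+\langle 11|$. Placing side by side is the tensor product, and connecting outputs to inputs is matrix multiplication. A scalar diagram is one with no inputs and no outputs; its interpretation is a complex number. Proposition. Let $D$ be a stabilizer scalar diagram with $\llbracket D\rrbracket\neq 0$. Then $$\llbracket D\rrbracket\in\left\{\sqrt{2^r}\,e^{is\pi/4} \;\middle|\; r,s\in\mathbb{Z}\right\}.$$ -/

import Mathlib

noncomputable section

/-- The phase labels `0, π/2, π, -π/2` of the stabilizer fragment. -/
inductive StabPhase : Type
  | zero
  | halfPi
  | pi
  | negHalfPi

/-- The angle, a real number, of a phase label. -/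
def StabPhase.angle : StabPhase → ℝ
  | .zero => 0
  | .halfPi => Real.pi / 2
  | .pi => Real.pi
  | .negHalfPi => -(Real.pi / 2)

/-- `StabDiagram n m` is the type of stabilizer ZX-calculus diagrams with `n` inputs and `m`
outputs. A diagram is assembled from green and red nodes with any numbers of inputs and outputs,
Hadamard nodes and star nodes by drawing them side by side (`tensor`), by connecting the outputs of
one diagram to the inputs of another one (`comp`), and by running edges straight (`wire`), across
each other (`swap`) or bent (`cup`, `cap`). `empty` is the empty diagram. -/
inductive StabDiagram : ℕ → ℕ → Type
  | green (n m : ℕ) (α : StabPhase) : StabDiagram n m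
  | red (n m : ℕ) (β : StabPhase) : StabDiagram n m
  | hadamard : StabDiagram 1 1
  | star : StabDiagram 0 0
  | empty : StabDiagram 0 0
  | wire : StabDiagram 1 1
  | swap : StabDiagram 2 2
  | cup : StabDiagram 0 2
  | cap : StabDiagram 2 0
  | tensor {n m n' m' : ℕ} (D : StabDiagram n m) (D' : StabDiagram n' m') :
      StabDiagram (n + n') (m + m')
  | comp {n m k : ℕ} (D : StabDiagram n m) (D' : StabDiagram m k) : StabDiagram n k

namespace StabDiagram

/-- Matrices of linear maps from `n` qubits to `m` qubits. Rows and columns are indexed by the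
computational basis, that is, by bit strings of length `m` and `n`. -/
abbrev QMatrix (n m : ℕ) : Type := Matrix (Fin m → Fin 2) (Fin n → Fin 2) ℂ

/-- `|0⟩` -/
def ket0 : Fin 2 → ℂ := ![1, 0]

/-- `|1⟩` -/
def ket1 : Fin 2 → ℂ := ![0, 1]

/-- `|+⟩ = (|0⟩ + |1⟩) / √2` -/
def ketPlus : Fin 2 → ℂ := ((1 / Real.sqrt 2 : ℝ) : ℂ) • (ket0 + ket1)

/-- `|-⟩ = (|0⟩ - |1⟩) / √2` -/
def ketMinus : Fin 2 → ℂ := ((1 / Real.sqrt 2 : ℝ) : ℂ) • (ket0 - ket1)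

/-- The `n`-fold tensor power of a one-qubit vector; for `n = 0` it is the scalar `1`. -/
def ketPow (v : Fin 2 → ℂ) (n : ℕ) : (Fin n → Fin 2) → ℂ := fun x => ∏ i, v (x i)

/-- `|v⟩^{⊗ m} ⟨w|^{⊗ n}` -/
def ketBra (v w : Fin 2 → ℂ) (n m : ℕ) : QMatrix n m :=
  Matrix.vecMulVec (ketPow v m) (Star.star (ketPow w n))

/-- The tensor (Kronecker) product of matrices, in terms of concatenated bit strings. -/
def kron {n m n' m' : ℕ} (A : QMatrix n m) (B : QMatrix n' m') : QMatrix (n + n') (m + m') :=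
  Matrix.of fun y x =>
    A (fun i => y (Fin.castAdd m' i)) (fun j => x (Fin.castAdd n' j)) *
      B (fun i => y (Fin.natAdd m i)) (fun j => x (Fin.natAdd n j))

/-- The matrix `⟦D⟧` that a diagram `D` stands for. -/
def interp : {n m : ℕ} → StabDiagram n m → QMatrix n m
  | _, _, green n m α =>
      ketBra ket0 ket0 n m + Complex.exp (Complex.I * α.angle) • ketBra ket1 ket1 n m
  | _, _, red n m β =>
      ketBra ketPlus ketPlus n m + Complex.exp (Complex.I * β.angle) • ketBra ketMinus ketMinus n m
  | _, _, hadamard => ketBra ketPlus ket0 1 1 + ketBra ketMinus ket1 1 1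
  | _, _, star => (1 / 2 : ℂ) • (1 : QMatrix 0 0)
  | _, _, empty => 1
  | _, _, wire => 1
  | _, _, swap => Matrix.of fun y x => if y 0 = x 1 ∧ y 1 = x 0 then 1 else 0
  | _, _, cup => Matrix.of fun y _ => if y 0 = y 1 then 1 else 0
  | _, _, cap => Matrix.of fun _ x => if x 0 = x 1 then 1 else 0
  | _, _, tensor D D' => kron (interp D) (interp D')
  | _, _, comp D D' => interp D' * interp D

/-- The complex number that a scalar diagram stands for: the only entry of its matrix. -/
def scalarValue (D : StabDiagram 0 0) : ℂ := interp D ![] ![]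

end StabDiagram

end

/-! Every entry of the matrix of a stabilizer diagram is a Gauss sum. As a function of the input and
output bits, the matrix of each generator is a scalar √2^r e^{isπ/4} times a sum, over a finite
auxiliary 2-group, of a quadratic function with values in the fourth roots of unity. This form
(`IsGauss`) survives products, pullback along homomorphisms and summation over bits, hence tensor
products and composition (`isGaussMatrix_interp`).

For a scalar diagram no free bits remain, so its value is such a scalar times one sum S over a
finite 2-group. Here S is a Gaussian integer, and polarization shows that |S|² is zero or a power of
two (`sum_mul_conj`). A Gaussian integer of norm 2^m is a unit times a power of 1 + i = √2 e^{iπ/4}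
(`of_norm_eq_two_pow`). -/

/-! ### Stabilizer scalars and Gaussian integers -/

/-- The nonzero numbers of the form `√2 ^ r * e^{isπ/4}` with integers `r` and `s`. -/
def IsStabScalar (c : ℂ) : Prop :=
  ∃ r s : ℤ, c = ((Real.sqrt 2 : ℝ) : ℂ) ^ r * Complex.exp (Complex.I * Real.pi / 4) ^ s

theorem sqrtTwo_ne_zero : ((Real.sqrt 2 : ℝ) : ℂ) ≠ 0 := by
  simp

theorem sqrtTwo_sq : ((Real.sqrt 2 : ℝ) : ℂ) ^ 2 = 2 := by
  rw [← Complex.ofReal_pow, Real.sq_sqrt (by norm_num)]; norm_num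

theorem zetaEight_sq : Complex.exp (Complex.I * Real.pi / 4) ^ 2 = Complex.I := by
  rw [← Complex.exp_nat_mul]
  refine Eq.trans ?_ Complex.exp_pi_div_two_mul_I
  congr 1
  push_cast
  ring

theorem sqrtTwo_mul_zetaEight :
    ((Real.sqrt 2 : ℝ) : ℂ) * Complex.exp (Complex.I * Real.pi / 4) = 1 + Complex.I := by
  have h : Complex.I * Real.pi / 4 = ((Real.pi / 4 : ℝ) : ℂ) * Complex.I := by push_cast; ring
  rw [h, Complex.exp_mul_I, ← Complex.ofReal_cos, ← Complex.ofReal_sin, Real.cos_pi_div_four,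
    Real.sin_pi_div_four]
  push_cast
  linear_combination ((1 + Complex.I) / 2) * sqrtTwo_sq

namespace IsStabScalar

theorem mul {a b : ℂ} (ha : IsStabScalar a) (hb : IsStabScalar b) : IsStabScalar (a * b) := by
  obtain ⟨r, s, rfl⟩ := ha
  obtain ⟨r', s', rfl⟩ := hb
  refine ⟨r + r', s + s', ?_⟩
  rw [zpow_add₀ sqrtTwo_ne_zero, zpow_add₀ (Complex.exp_ne_zero _)]
  ring

theorem one : IsStabScalar 1 := ⟨0, 0, by simp⟩

theorem I : IsStabScalar Complex.I :=
  ⟨0, 2, by rw [zpow_zero, one_mul, zpow_ofNat, zetaEight_sq]⟩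

theorem neg_one : IsStabScalar (-1) := by
  simpa using I.mul I

theorem one_add_I : IsStabScalar (1 + Complex.I) :=
  ⟨1, 1, by rw [zpow_one, zpow_one, sqrtTwo_mul_zetaEight]⟩

theorem one_div_sqrtTwo : IsStabScalar ((1 / Real.sqrt 2 : ℝ) : ℂ) :=
  ⟨-1, 0, by simp⟩

theorem half : IsStabScalar (1 / 2) := by
  refine ⟨-2, 0, ?_⟩
  rw [zpow_zero, mul_one, zpow_neg, zpow_ofNat, sqrtTwo_sq, one_div]

/-- A Gaussian integer whose norm is a power of two is a power of `1 + i` up to a unit. -/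
theorem of_norm_eq_two_pow (m : ℕ) (a b : ℤ) (h : a ^ 2 + b ^ 2 = 2 ^ m) :
    IsStabScalar (a + b * Complex.I) := by
  induction m generalizing a b with
  | zero =>
    rw [pow_zero] at h
    have ha : -1 ≤ a ∧ a ≤ 1 := by constructor <;> nlinarith [sq_nonneg b]
    have hb : -1 ≤ b ∧ b ≤ 1 := by constructor <;> nlinarith [sq_nonneg a]
    obtain ⟨ha₁, ha₂⟩ := ha
    obtain ⟨hb₁, hb₂⟩ := hb
    interval_cases a <;> interval_cases b <;> simp at h
    · simpa using neg_one
    · simpa using neg_one.mul I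
    · simpa using I
    · simpa using one
  | succ m ih =>
    -- An even norm forces a and b to have equal parity, so 1 + i divides: with 2p = a + b, the
    -- quotient is p + (b - p)i, of half the norm.
    have hpar : Even (a + b) := by
      have h2 : Even (a ^ 2 + b ^ 2) := by
        rw [h, pow_succ]; exact even_two.mul_left _
      rw [Int.even_add, Int.even_pow' two_ne_zero, Int.even_pow' two_ne_zero] at h2
      rwa [Int.even_add]
    obtain ⟨p, hp⟩ := hpar
    obtain rfl : a = p + p - b := by omega
    have hpq : p ^ 2 + (b - p) ^ 2 = 2 ^ m := by
      rw [pow_succ 2 m] at h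
      linarith [show (p + p - b) ^ 2 + b ^ 2 = 2 * (p ^ 2 + (b - p) ^ 2) by ring]
    convert one_add_I.mul (ih p (b - p) hpq) using 1
    push_cast
    linear_combination (p - b : ℂ) * Complex.I_sq

end IsStabScalar

/-! ### Quadratic Gauss sums on finite abelian groups -/

/-- `g` takes fourth roots of unity as values and is quadratic: its third multiplicative
differences are trivial. -/
structure IsQuadratic {V : Type} [AddCommGroup V] (g : V → ℂ) : Prop where
  pow_four : ∀ v, g v ^ 4 = 1
  cubic : ∀ x y z, g (x + y + z) * g x * g y * g z = g (x + y) * g (y + z) * g (x + z) * g 0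

namespace IsQuadratic

variable {V W : Type} [AddCommGroup V] [AddCommGroup W] {g : V → ℂ}

theorem mul {g' : V → ℂ} (hg : IsQuadratic g) (hg' : IsQuadratic g') :
    IsQuadratic fun v => g v * g' v where
  pow_four v := by rw [mul_pow, hg.pow_four, hg'.pow_four, one_mul]
  cubic x y z := by
    linear_combination (g' (x + y + z) * g' x * g' y * g' z) * hg.cubic x y z +
      (g (x + y) * g (y + z) * g (x + z) * g 0) * hg'.cubic x y z

theorem comp (hg : IsQuadratic g) (φ : W →+ V) : IsQuadratic fun w => g (φ w) where
  pow_four w := hg.pow_four _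
  cubic x y z := by simpa using hg.cubic (φ x) (φ y) (φ z)

theorem ne_zero (hg : IsQuadratic g) (v : V) : g v ≠ 0 := by
  intro h
  simpa [h] using hg.pow_four v

theorem eq_or (hg : IsQuadratic g) (v : V) :
    g v = 1 ∨ g v = -1 ∨ g v = Complex.I ∨ g v = -Complex.I := by
  have h : (g v - 1) * ((g v + 1) * ((g v - Complex.I) * (g v + Complex.I))) = 0 := by
    linear_combination hg.pow_four v - (g v ^ 2 - 1) * Complex.I_sq
  simpa [sub_eq_zero, add_eq_zero_iff_eq_neg] using h

theorem conj_eq (hg : IsQuadratic g) (v : V) : (starRingEnd ℂ) (g v) = (g v)⁻¹ := by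
  rcases hg.eq_or v with h | h | h | h <;> simp [h, inv_neg]

theorem sum_eq_gaussian [Fintype V] (hg : IsQuadratic g) :
    ∃ a b : ℤ, ∑ v, g v = a + b * Complex.I := by
  have hv : ∀ v, ∃ z : GaussianInt, g v = z := by
    intro v
    rcases hg.eq_or v with h | h | h | h
    · exact ⟨1, by simp [h]⟩
    · exact ⟨-1, by simp [h]⟩
    · exact ⟨⟨0, 1⟩, by simp [h, GaussianInt.toComplex_def]⟩
    · exact ⟨⟨0, -1⟩, by simp [h, GaussianInt.toComplex_def]⟩
  choose z hz using hv
  refine ⟨(∑ v, z v).re, (∑ v, z v).im, ?_⟩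
  rw [← GaussianInt.toComplex_def, map_sum]
  exact Finset.sum_congr rfl fun v _ => hz v

/-- The polarization of a quadratic function, as a character of its second argument. -/
noncomputable def polar (hg : IsQuadratic g) (h : V) : AddChar V ℂ where
  toFun y := g (y + h) * g 0 / (g y * g h)
  map_zero_eq_one' := by
    have h0 := hg.ne_zero 0
    have hh := hg.ne_zero h
    rw [zero_add]
    field_simp
  map_add_eq_mul' x y := by
    have h0 := hg.ne_zero 0
    have hh := hg.ne_zero h
    have hx := hg.ne_zero x
    have hy := hg.ne_zero y
    have hxy := hg.ne_zero (x + y)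
    field_simp
    linear_combination hg.cubic x y h

theorem polar_apply (hg : IsQuadratic g) (h y : V) :
    hg.polar h y = g (y + h) * g 0 / (g y * g h) := rfl

theorem polar_comm (hg : IsQuadratic g) (h y : V) : hg.polar h y = hg.polar y h := by
  rw [polar_apply, polar_apply, add_comm, mul_comm (g y)]

/-- The radical of the polarization. -/
def radical (hg : IsQuadratic g) : AddSubgroup V where
  carrier := {h | hg.polar h = 0}
  zero_mem' := by
    ext y
    rw [polar_comm, AddChar.map_zero_eq_one, AddChar.zero_apply]
  add_mem' {a b} ha hb := by
    ext y
    rw [polar_comm, AddChar.map_add_eq_mul, polar_comm, hg.polar_comm y b,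
      show hg.polar a = 0 from ha, show hg.polar b = 0 from hb]
    simp
  neg_mem' {a} ha := by
    ext y
    rw [polar_comm, AddChar.map_neg_eq_inv, polar_comm, show hg.polar a = 0 from ha]
    simp

/-- On the radical, a quadratic function is a character up to a constant. -/
noncomputable def radicalChar (hg : IsQuadratic g) : AddChar hg.radical ℂ where
  toFun h := g h / g 0
  map_zero_eq_one' := div_self (hg.ne_zero 0)
  map_add_eq_mul' x y := by
    have h0 := hg.ne_zero 0
    have hx := hg.ne_zero x
    have hy := hg.ne_zero y
    -- Triviality of the polarization at y says exactly that g(x + y) g(0) = g(x) g(y).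
    have h : hg.polar y x = 1 := by rw [show hg.polar y = 0 from y.2, AddChar.zero_apply]
    rw [polar_apply, div_eq_one_iff_eq (mul_ne_zero hx hy)] at h
    rw [AddSubgroup.coe_add]
    field_simp
    exact h

/-- Conjugation inverts g, so |S|² is a double sum of quotients g(y + h)/g(y). For fixed h this is
g(h)/g(0) times the polarization at h, a character of y, whose sum over y vanishes unless h lies in
the radical. -/
theorem sum_mul_conj [Fintype V] (hg : IsQuadratic g) [Fintype hg.radical] :
    (∑ v, g v) * (starRingEnd ℂ) (∑ v, g v) = Fintype.card V * ∑ h, hg.radicalChar h := by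
  classical
  have h0 := hg.ne_zero 0
  calc (∑ v, g v) * (starRingEnd ℂ) (∑ v, g v)
      = ∑ y, ∑ h, g (y + h) * (g y)⁻¹ := by
        rw [map_sum, Finset.mul_sum]
        refine Finset.sum_congr rfl fun y _ => ?_
        rw [← Finset.sum_mul, hg.conj_eq,
          ← Fintype.sum_equiv (Equiv.addLeft y) (fun h => g (y + h)) g fun _ => rfl]
    _ = ∑ h, g h / g 0 * ∑ y, hg.polar h y := by
        rw [Finset.sum_comm]
        refine Finset.sum_congr rfl fun h _ => ?_
        rw [Finset.mul_sum]
        refine Finset.sum_congr rfl fun y _ => ?_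
        have hh := hg.ne_zero h
        have hy := hg.ne_zero y
        rw [polar_apply]
        field_simp
    _ = ∑ h with h ∈ hg.radical, Fintype.card V * (g h / g 0) := by
        rw [Finset.sum_filter]
        refine Finset.sum_congr rfl fun h _ => ?_
        rw [AddChar.sum_eq_ite, show h ∈ hg.radical ↔ hg.polar h = 0 from Iff.rfl]
        split_ifs <;> ring
    _ = Fintype.card V * ∑ h, hg.radicalChar h := by
        rw [← Finset.mul_sum, ← Finset.sum_subtype_eq_sum_filter, Finset.subtype_univ]
        rfl

/-- A quadratic Gauss sum over a finite abelian `2`-group vanishes or is `√2 ^ r * e^{isπ/4}`. -/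
theorem sum_eq_zero_or [Fintype V] (hg : IsQuadratic g) (hV : ∃ k, Fintype.card V = 2 ^ k) :
    ∑ v, g v = 0 ∨ IsStabScalar (∑ v, g v) := by
  classical
  obtain ⟨a, b, hab⟩ := hg.sum_eq_gaussian
  obtain ⟨k, hk⟩ := hV
  have hdvd : Fintype.card hg.radical ∣ 2 ^ k := by
    rw [← hk, ← Nat.card_eq_fintype_card, ← Nat.card_eq_fintype_card]
    exact hg.radical.card_addSubgroup_dvd_card
  obtain ⟨l, -, hl⟩ := (Nat.dvd_prime_pow Nat.prime_two).1 hdvd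
  have hnorm := hg.sum_mul_conj
  -- Over the radical, of order 2^l, the character sums to 2^l or 0, so |S|² is 2^(k+l) or 0.
  rw [AddChar.sum_eq_ite] at hnorm
  split_ifs at hnorm
  · right
    rw [hab]
    refine IsStabScalar.of_norm_eq_two_pow (k + l) a b ?_
    rw [hab, hk, hl] at hnorm
    have h : ((a ^ 2 + b ^ 2 : ℤ) : ℂ) = ((2 ^ (k + l) : ℤ) : ℂ) := by
      simp only [map_add, map_mul, Complex.conj_I, map_intCast] at hnorm
      push_cast at hnorm ⊢
      rw [pow_add]
      linear_combination hnorm + (b : ℂ) ^ 2 * Complex.I_sq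
    exact_mod_cast h
  · left
    rw [mul_zero, mul_eq_zero, map_eq_zero, or_self] at hnorm
    exact hnorm

end IsQuadratic

/-! ### Gauss functions and their closure properties -/

/-- `f` is, up to a scalar, a sum of a quadratic function over the elements of a finite
`2`-group. -/
def IsGauss {X : Type} [AddCommGroup X] (f : X → ℂ) : Prop :=
  ∃ (V : Type) (_ : AddCommGroup V) (_ : Fintype V) (c : ℂ) (g : X × V → ℂ),
    (∃ k, Fintype.card V = 2 ^ k) ∧ IsStabScalar c ∧ IsQuadratic g ∧ ∀ x, f x = c * ∑ v, g (x, v)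

theorem IsQuadratic.isGauss {X : Type} [AddCommGroup X] {g : X → ℂ} (hg : IsQuadratic g) :
    IsGauss g :=
  ⟨Unit, inferInstance, inferInstance, 1, fun p => g p.1, ⟨0, rfl⟩, .one,
    hg.comp (AddMonoidHom.fst X Unit), fun x => by simp⟩

namespace IsGauss

variable {X Y : Type} [AddCommGroup X] [AddCommGroup Y]

theorem eq_zero_or {f : X → ℂ} (hf : IsGauss f) : f 0 = 0 ∨ IsStabScalar (f 0) := by
  obtain ⟨V, _, _, c, g, hV, hc, hg, h⟩ := hf
  rw [h]
  rcases (hg.comp (AddMonoidHom.inr X V)).sum_eq_zero_or hV with h0 | h0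
  · left
    exact mul_eq_zero_of_right c h0
  · right
    exact hc.mul h0

theorem mul {f f' : X → ℂ} (hf : IsGauss f) (hf' : IsGauss f') : IsGauss fun x => f x * f' x := by
  obtain ⟨V, _, _, c, g, ⟨k, hk⟩, hc, hg, h⟩ := hf
  obtain ⟨V', _, _, c', g', ⟨k', hk'⟩, hc', hg', h'⟩ := hf'
  refine ⟨V × V', inferInstance, inferInstance, c * c',
    fun p => g (p.1, p.2.1) * g' (p.1, p.2.2), ⟨k + k', ?_⟩, hc.mul hc',
    (hg.comp ((AddMonoidHom.fst X (V × V')).prod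
      ((AddMonoidHom.fst V V').comp (AddMonoidHom.snd X (V × V'))))).mul
    (hg'.comp ((AddMonoidHom.fst X (V × V')).prod
      ((AddMonoidHom.snd V V').comp (AddMonoidHom.snd X (V × V'))))), fun x => ?_⟩
  · rw [Fintype.card_prod, hk, hk', pow_add]
  · simp only [h, h', Fintype.sum_prod_type, mul_mul_mul_comm c, Finset.sum_mul_sum]

theorem comp {f : X → ℂ} (hf : IsGauss f) (φ : Y →+ X) : IsGauss fun y => f (φ y) := by
  obtain ⟨V, _, _, c, g, hV, hc, hg, h⟩ := hf
  exact ⟨V, _, _, c, fun p => g (φ p.1, p.2), hV, hc,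
    hg.comp (φ.prodMap (AddMonoidHom.id V)), fun y => h _⟩

theorem sum [Fintype Y] {f : X × Y → ℂ} (hf : IsGauss f) (hY : ∃ k, Fintype.card Y = 2 ^ k) :
    IsGauss fun x => ∑ y, f (x, y) := by
  obtain ⟨V, _, _, c, g, ⟨k, hk⟩, hc, hg, h⟩ := hf
  obtain ⟨l, hl⟩ := hY
  refine ⟨Y × V, inferInstance, inferInstance, c, fun p => g ((p.1, p.2.1), p.2.2), ⟨l + k, ?_⟩, hc,
    hg.comp (AddEquiv.prodAssoc (M := X) (N := Y) (P := V)).symm.toAddMonoidHom, fun x => ?_⟩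
  · rw [Fintype.card_prod, hk, hl, pow_add]
  · rw [Fintype.sum_prod_type, Finset.mul_sum]
    exact Finset.sum_congr rfl fun y _ => h _

theorem const {c : ℂ} (hc : IsStabScalar c) : IsGauss fun _ : X => c :=
  ⟨Unit, inferInstance, inferInstance, c, fun _ => 1, ⟨0, rfl⟩, hc,
    ⟨fun _ => one_pow 4, fun _ _ _ => rfl⟩, fun x => by simp⟩

theorem prod {ι : Type} (s : Finset ι) {f : ι → X → ℂ} (hf : ∀ i, IsGauss (f i)) :
    IsGauss fun x => ∏ i ∈ s, f i x := by
  classical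
  induction s using Finset.induction_on with
  | empty => simpa using const IsStabScalar.one
  | insert i s hi ih => simpa only [Finset.prod_insert hi] using (hf i).mul ih

end IsGauss

/-! ### Gauss functions of bits -/

/-- `(-1) ^ (x * z)` for bits `x` and `z`. -/
def bitSign (p : Fin 2 × Fin 2) : ℂ := if p.1 = 1 ∧ p.2 = 1 then -1 else 1

theorem isQuadratic_bitSign : IsQuadratic bitSign where
  pow_four v := by rw [bitSign]; split_ifs <;> norm_num
  cubic := by simp [bitSign, Prod.forall, Fin.forall_fin_two]

/-- The indicator of x = 0 is the average of (-1)^(xz) over the bit z. -/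
theorem isGauss_ite_eq_zero : IsGauss fun x : Fin 2 => if x = 0 then (1 : ℂ) else 0 := by
  refine ⟨Fin 2, inferInstance, inferInstance, 1 / 2, bitSign, ⟨1, rfl⟩, .half,
    isQuadratic_bitSign, ?_⟩
  simp [Fin.forall_fin_two, bitSign]
  norm_num

theorem isGauss_ite_eq {X : Type} [AddCommGroup X] (φ ψ : X →+ Fin 2) :
    IsGauss fun x => if φ x = ψ x then (1 : ℂ) else 0 := by
  simpa [sub_eq_zero] using isGauss_ite_eq_zero.comp (φ - ψ)

theorem exp_I_mul_angle_pow_four (α : StabPhase) : Complex.exp (Complex.I * α.angle) ^ 4 = 1 := by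
  have h : ∀ n : ℤ, α.angle = n * (Real.pi / 2) →
      Complex.exp (Complex.I * α.angle) ^ 4 = 1 := by
    intro n hn
    rw [hn, ← Complex.exp_nat_mul, Complex.exp_eq_one_iff]
    exact ⟨n, by push_cast; ring⟩
  cases α
  · exact h 0 (by simp [StabPhase.angle])
  · exact h 1 (by simp [StabPhase.angle])
  · exact h 2 (by simp [StabPhase.angle]; ring)
  · exact h (-1) (by simp [StabPhase.angle])

/-- The cubic identity has content only at x = y = z = 1, where it says that the phase is a fourth
root of unity. -/
theorem isGauss_phase (α : StabPhase) :
    IsGauss fun z : Fin 2 => if z = 0 then 1 else Complex.exp (Complex.I * α.angle) := by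
  have h := exp_I_mul_angle_pow_four α
  refine IsQuadratic.isGauss ⟨?_, ?_⟩
  · simp [h]
  · simp [Fin.forall_fin_two]
    linear_combination h

/-! ### Matrices of diagrams -/

namespace StabDiagram

/-- The entry of `|+⟩` (for `z = 0`) or `|-⟩` (for `z = 1`) at the bit `x`. -/
theorem ket_eq (p : Fin 2 × Fin 2) :
    (if p.2 = 0 then ketPlus p.1 else ketMinus p.1) =
      ((1 / Real.sqrt 2 : ℝ) : ℂ) * bitSign p := by
  obtain ⟨x, z⟩ := p
  fin_cases x <;> fin_cases z <;> simp [ketPlus, ketMinus, ket0, ket1, bitSign]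

theorem isGauss_ketPlusMinus :
    IsGauss fun p : Fin 2 × Fin 2 => if p.2 = 0 then ketPlus p.1 else ketMinus p.1 := by
  simp_rw [ket_eq]
  exact (IsGauss.const .one_div_sqrtTwo).mul isQuadratic_bitSign.isGauss

theorem isGauss_ket01 :
    IsGauss fun p : Fin 2 × Fin 2 => if p.2 = 0 then ket0 p.1 else ket1 p.1 := by
  convert isGauss_ite_eq (AddMonoidHom.fst (Fin 2) (Fin 2)) (AddMonoidHom.snd (Fin 2) (Fin 2))
    using 2 with p
  obtain ⟨x, z⟩ := p
  fin_cases x <;> fin_cases z <;> simp [ket0, ket1]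

theorem star_ket (x : Fin 2) : Star.star (ket0 x) = ket0 x ∧ Star.star (ket1 x) = ket1 x ∧
    Star.star (ketPlus x) = ketPlus x ∧ Star.star (ketMinus x) = ketMinus x := by
  fin_cases x <;> simp [ket0, ket1, ketPlus, ketMinus]

/-- The matrix of `A`, as a function of output and input bits, is a Gauss function. -/
def IsGaussMatrix {n m : ℕ} (A : QMatrix n m) : Prop :=
  IsGauss fun p : (Fin m → Fin 2) × (Fin n → Fin 2) => A p.1 p.2

theorem ketBra_apply {v w : Fin 2 → ℂ} (hw : ∀ x, Star.star (w x) = w x) (n m : ℕ)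
    (y : Fin m → Fin 2) (x : Fin n → Fin 2) :
    ketBra v w n m y x = (∏ i, v (y i)) * ∏ j, w (x j) := by
  simp only [ketBra, ketPow, Matrix.vecMulVec_apply, Pi.star_apply, star_prod, hw]

/-- The projection to an output bit. -/
def outBit (n m : ℕ) (i : Fin m) :
    ((Fin m → Fin 2) × (Fin n → Fin 2)) →+ Fin 2 :=
  (Pi.evalAddMonoidHom _ i).comp (AddMonoidHom.fst _ _)

/-- The projection to an input bit. -/
def inBit (n m : ℕ) (j : Fin n) :
    ((Fin m → Fin 2) × (Fin n → Fin 2)) →+ Fin 2 :=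
  (Pi.evalAddMonoidHom _ j).comp (AddMonoidHom.snd _ _)

/-- A hidden bit z selects one of the two summands. The phase depends on z alone and each leg on z
and its own bit; multiply these factors and sum over z. -/
theorem isGaussMatrix_spider {v w : Fin 2 → ℂ}
    (hvw : IsGauss fun p : Fin 2 × Fin 2 => if p.2 = 0 then v p.1 else w p.1)
    (hv : ∀ x, Star.star (v x) = v x) (hw : ∀ x, Star.star (w x) = w x) (n m : ℕ)
    (α : StabPhase) :
    IsGaussMatrix (ketBra v v n m + Complex.exp (Complex.I * α.angle) • ketBra w w n m) := by
  have h := (((isGauss_phase α).comp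
      (AddMonoidHom.snd ((Fin m → Fin 2) × (Fin n → Fin 2)) (Fin 2))).mul
    ((IsGauss.prod Finset.univ fun i => hvw.comp ((outBit n m i).prodMap (.id _))).mul
      (IsGauss.prod Finset.univ fun j => hvw.comp ((inBit n m j).prodMap (.id _))))).sum ⟨1, rfl⟩
  unfold IsGaussMatrix
  convert h using 2 with p
  simp [Fin.sum_univ_two, ketBra_apply hv, ketBra_apply hw, outBit, inBit]

/-- The input bit itself plays the role of the label choosing between |+⟩ and |-⟩. -/
theorem isGaussMatrix_hadamard :
    IsGaussMatrix (ketBra ketPlus ket0 1 1 + ketBra ketMinus ket1 1 1) := by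
  have h := isGauss_ketPlusMinus.comp ((outBit 1 1 0).prod (inBit 1 1 0))
  unfold IsGaussMatrix
  convert h using 2 with p
  obtain ⟨y, x⟩ := p
  simp only [Matrix.add_apply, ketBra_apply fun x => (star_ket x).1,
    ketBra_apply fun x => (star_ket x).2.1, outBit, inBit]
  generalize hx : x 0 = b
  fin_cases b <;> simp [hx, ket0, ket1]

theorem isGaussMatrix_one (n : ℕ) : IsGaussMatrix (1 : QMatrix n n) := by
  have h := IsGauss.prod Finset.univ fun i => isGauss_ite_eq (outBit n n i) (inBit n n i)
  unfold IsGaussMatrix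
  convert h using 2 with p
  simp [Matrix.one_apply, Finset.prod_ite_zero, funext_iff, outBit, inBit]

theorem isGaussMatrix_swap :
    IsGaussMatrix (Matrix.of fun y x => if y 0 = x 1 ∧ y 1 = x 0 then 1 else 0 : QMatrix 2 2) := by
  have h := (isGauss_ite_eq (outBit 2 2 0) (inBit 2 2 1)).mul
    (isGauss_ite_eq (outBit 2 2 1) (inBit 2 2 0))
  unfold IsGaussMatrix
  convert h using 2 with p
  simp [← ite_and, and_comm, outBit, inBit]

theorem isGaussMatrix_kron {n m n' m' : ℕ} {A : QMatrix n m} {B : QMatrix n' m'}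
    (hA : IsGaussMatrix A) (hB : IsGaussMatrix B) : IsGaussMatrix (kron A B) :=
  (hA.comp ((AddMonoidHom.mk' (fun (y : Fin (m + m') → Fin 2) i => y (Fin.castAdd m' i))
      fun _ _ => rfl).prodMap
    (AddMonoidHom.mk' (fun (x : Fin (n + n') → Fin 2) j => x (Fin.castAdd n' j))
      fun _ _ => rfl))).mul
  (hB.comp ((AddMonoidHom.mk' (fun (y : Fin (m + m') → Fin 2) i => y (Fin.natAdd m i))
      fun _ _ => rfl).prodMap
    (AddMonoidHom.mk' (fun (x : Fin (n + n') → Fin 2) j => x (Fin.natAdd n j))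
      fun _ _ => rfl)))

/-- The bits on the connecting edges become summation variables, ranging over a group of order 2^m.
-/
theorem isGaussMatrix_mul {n m k : ℕ} {A : QMatrix n m} {B : QMatrix m k}
    (hA : IsGaussMatrix A) (hB : IsGaussMatrix B) : IsGaussMatrix (B * A) :=
  ((hB.comp ((AddMonoidHom.fst (Fin k → Fin 2) (Fin n → Fin 2)).prodMap
      (AddMonoidHom.id (Fin m → Fin 2)))).mul
    (hA.comp ((AddMonoidHom.snd ((Fin k → Fin 2) × (Fin n → Fin 2)) (Fin m → Fin 2)).prod
      ((AddMonoidHom.snd (Fin k → Fin 2) (Fin n → Fin 2)).comp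
        (AddMonoidHom.fst _ (Fin m → Fin 2)))))).sum ⟨m, by simp⟩

theorem isGaussMatrix_interp {n m : ℕ} (D : StabDiagram n m) : IsGaussMatrix D.interp := by
  induction D with
  | green n m α =>
    exact isGaussMatrix_spider isGauss_ket01 (fun x => (star_ket x).1)
      (fun x => (star_ket x).2.1) n m α
  | red n m β =>
    exact isGaussMatrix_spider isGauss_ketPlusMinus (fun x => (star_ket x).2.2.1)
      (fun x => (star_ket x).2.2.2) n m β
  | hadamard => exact isGaussMatrix_hadamard
  | star => exact (IsGauss.const .half).mul (isGaussMatrix_one 0)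
  | empty => exact isGaussMatrix_one 0
  | wire => exact isGaussMatrix_one 1
  | swap => exact isGaussMatrix_swap
  | cup => exact isGauss_ite_eq (outBit 0 2 0) (outBit 0 2 1)
  | cap => exact isGauss_ite_eq (inBit 2 0 0) (inBit 2 0 1)
  | tensor D D' ih ih' => exact isGaussMatrix_kron ih ih'
  | comp D D' ih ih' => exact isGaussMatrix_mul ih ih'

end StabDiagram

theorem mainTheorem6 (D : StabDiagram 0 0) (hD : D.interp ≠ 0) :
    D.scalarValue ∈ {z : ℂ | ∃ r s : ℤ,
      z = ((Real.sqrt ((2 : ℝ) ^ r) : ℝ) : ℂ) *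
        Complex.exp (Complex.I * (s : ℂ) * (Real.pi : ℂ) / 4)} := by
  rcases D.isGaussMatrix_interp.eq_zero_or with h | ⟨r, s, h⟩
  · refine absurd ?_ hD
    ext y x
    -- There is only one entry, so if it vanishes the whole matrix does.
    rw [Subsingleton.elim y 0, Subsingleton.elim x 0]
    exact h
  · refine ⟨r, s,
      (congrArg₂ D.interp (Subsingleton.elim _ _) (Subsingleton.elim _ _)).trans (h.trans ?_)⟩
    have hr : Real.sqrt ((2 : ℝ) ^ r) = Real.sqrt 2 ^ r := by
      rw [Real.sqrt_eq_iff_mul_self_eq (by positivity) (by positivity), ← mul_zpow,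
        Real.mul_self_sqrt (by norm_num)]
    rw [hr, Complex.ofReal_zpow, ← Complex.exp_int_mul]
    congr 2
    ring
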